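/- Let $P>0$. For each blocklength $n$ consider the Gaussian many-access channel with $\ell_n$ users: the received vector is $\mathbf Y=\sum_{k=1}^{\ell_n}\mathbf S_k(W_k)+\mathbf Z\in\mathbb R^n$, where $\mathbf Z$ has independent standard Gaussian entries, independent of the messages, and the messages $W_1,\dots,W_{\ell_n}\in\{0,1,\dots,M\}$ are independent with $\mathsf P\{W_k=0\}=1-\alpha_n$ and $\mathsf P\{W_k=w\}=\alpha_n/M$ for $w=1,\dots,M$, where $\alpha_n\in[0,1]$. An $(M,n)$ symmetric code with power constraint $P$ consists of encoders $w\mapsto \mathbf S_k(w)=(s_{k1}(w),\dots,s_{kn}(w))\in\mathbb R^n$, $k=1,\dots,\ell_n$, with $\mathbf S_k(0)=\mathbf 0$ and $\frac1n\sum_{i=1}^n s_{ki}(w)^2\le P$ for all $k$ and $w$, and of a (measurable) decoder $\mathcal D:\mathbb R^n\to\{0,\dots,M\}^{\ell_n}$; its average error probability is $\mathsf P\{\mathcal D(\mathbf Y)\ne(W_1,\dots,W_{\ell_n})\}$. A sequence of message lengths $v(n)$ (in nats) is called asymptotically achievable if there is a sequence of $(\lceil e^{v(n)}\rceil,n)$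 symmetric codes with power constraint $P$ whose average error probability tends to $0$ as $n\to\infty$. Let $H_2(p)=-p\log p-(1-p)\log(1-p)$, with natural logarithms. **Theorem.** Suppose that $\ell_n$ is unbounded and that the average number of active users $k_n=\alpha_n\ell_n$ is bounded. Let $s_n$ be any increasing (not necessarily strictly) sequence of real numbers such that $s_n\le\ell_n$ for all large $n$, $s_n=O(n)$, $\ell_n e^{-\delta s_n}\to0$ for every $\delta>0$, and $$\lim_{n\to\infty}\frac{2\,\ell_n H_2(s_n/\ell_n)}{n\log(1+s_nP)}$$ exists and is less than $1$. Then, for every $\varepsilon\in(0,1)$, the message length $$(1-\varepsilon)\left(\frac{n}{2s_n}\log(1+s_nP)-H_2\!\left(\frac{s_n}{\ell_n}\right)\right)$$ is asymptotically achievable. -/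

import Mathlib

open MeasureTheory ProbabilityTheory Filter Topology Asymptotics

/-- An `(M, n)` symmetric code with power constraint `P` for the Gaussian many-access channel with
`ℓ` users. Message `0` stands for silence, and `1, …, M` are the proper messages. -/
structure SymmetricCode (ℓ M n : ℕ) (P : ℝ) where
  /-- `encode k w` is the codeword of length `n` that user `k` sends for the message `w`. -/
  encode : Fin ℓ → Fin (M + 1) → (Fin n → ℝ)
  encode_zero : ∀ k, encode k 0 = 0
  power_le : ∀ k w, (1 / (n : ℝ)) * ∑ i, encode k w i ^ 2 ≤ P
  /-- The deterministic decision on all messages, given the received vector. -/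
  decode : (Fin n → ℝ) → (Fin ℓ → Fin (M + 1))
  measurable_decode : Measurable decode

/-- The law of the message of one user: `0` with probability `1 - α`, and each of `1, …, M` with
probability `α / M`. -/
noncomputable def messageLaw (M : ℕ) (α : ℝ) : Measure (Fin (M + 1)) :=
  ∑ w : Fin (M + 1), (if w = 0 then ENNReal.ofReal (1 - α) else ENNReal.ofReal (α / M)) •
    Measure.dirac w

/-- The law of the noise vector: `n` independent standard Gaussian entries. -/
noncomputable def noiseLaw (n : ℕ) : Measure (Fin n → ℝ) :=
  Measure.pi fun _ => gaussianReal 0 1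

namespace SymmetricCode

variable {ℓ M n : ℕ} {P : ℝ}

/-- The received vector, when the messages are `w` and the noise is `z`. -/
def received (C : SymmetricCode ℓ M n P) (w : Fin ℓ → Fin (M + 1)) (z : Fin n → ℝ) :
    Fin n → ℝ :=
  ∑ k, C.encode k (w k) + z

/-- The average error probability: the probability that the decoder's output differs from the
vector of all messages, where the messages of the users and the noise are independent. -/
noncomputable def errorProb (C : SymmetricCode ℓ M n P) (α : ℝ) : ENNReal :=
  ((Measure.pi fun _ : Fin ℓ => messageLaw M α).prod (noiseLaw n))
    {p | C.decode (C.received p.1 p.2) ≠ p.1}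

end SymmetricCode

/-- The message length `v` (in nats) is asymptotically achievable for the Gaussian many-access
channel with `ℓ n` users, activity probability `α n` and power constraint `P`: there are
`(⌈exp (v n)⌉, n)` codes whose average error probability vanishes. Message lengths are usually
positive and nondecreasing sequences; the definition makes sense for every real sequence. -/
def AsymptoticallyAchievable (ℓ : ℕ → ℕ) (α : ℕ → ℝ) (P : ℝ) (v : ℕ → ℝ) : Prop :=
  ∃ C : ∀ n, SymmetricCode (ℓ n) ⌈Real.exp (v n)⌉₊ n P,
    Tendsto (fun n => (C n).errorProb (α n)) atTop (𝓝 0)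

/-! The assumptions force `s n → ∞` and `log (ℓ n) = o(n)`, so the message length, at most `n log(1
+ s n P) / (2 s n)`, is `o(n)`. A crude random coding argument then suffices
(`asymptoticallyAchievable_of_sublinear`). Since the mean number of active users is bounded,
Markov's inequality gives a constant `A`, independent of `n`, exceeded by that number only with
small probability. At most `e (M ℓ)^A` message vectors have `A` or fewer active users, and this is
`exp (o(n))`. With random antipodal codewords, two distinct vectors are confused with average
probability at most `ρ^n`, where `ρ = (1 + exp(-P/8)) / 2 < 1` (`sum_exp_sum_signedSum_sub_le`). The
union bound over pairs is therefore exponentially small. -/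

/-! ### Gaussian noise and pairwise errors -/

instance (n : ℕ) : IsProbabilityMeasure (noiseLaw n) := by
  unfold noiseLaw; infer_instance

lemma mgf_sum_mul_noiseLaw {n : ℕ} (d : Fin n → ℝ) (t : ℝ) :
    mgf (fun z : Fin n → ℝ => ∑ i, d i * z i) (noiseLaw n) t =
      Real.exp (t ^ 2 * (∑ i, d i ^ 2) / 2) := by
  have h : ∀ z : Fin n → ℝ, Real.exp (t * ∑ i, d i * z i) =
      ∏ i, Real.exp ((t * d i) * z i) := by
    intro z
    rw [← Real.exp_sum, Finset.mul_sum]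
    simp_rw [mul_assoc]
  unfold mgf noiseLaw
  simp_rw [h]
  rw [integral_fintype_prod_eq_prod (fun i (x : ℝ) => Real.exp ((t * d i) * x))]
  have h2 : ∀ i, ∫ x, Real.exp ((t * d i) * x) ∂(gaussianReal 0 1) =
      Real.exp ((t * d i) ^ 2 / 2) := by
    intro i
    have := congrFun (mgf_id_gaussianReal (μ := 0) (v := 1)) (t * d i)
    simpa [mgf] using this
  simp_rw [h2]
  rw [← Real.exp_sum, Finset.mul_sum, Finset.sum_div]
  simp_rw [mul_pow]

lemma integrable_exp_sum_mul_noiseLaw {n : ℕ} (d : Fin n → ℝ) (t : ℝ) :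
    Integrable (fun z : Fin n → ℝ => Real.exp (t * ∑ i, d i * z i)) (noiseLaw n) := by
  have h : (fun z : Fin n → ℝ => Real.exp (t * ∑ i, d i * z i)) =
      fun z => ∏ i, Real.exp ((t * d i) * z i) := by
    funext z
    rw [← Real.exp_sum, Finset.mul_sum]
    simp_rw [mul_assoc]
  rw [h]
  exact Integrable.fintype_prod (f := fun i (x : ℝ) => Real.exp ((t * d i) * x))
    fun i => integrable_exp_mul_gaussianReal _

/-- The noise moves a point at least as close to a competitor at displacement `d` with probability
at most `exp (-‖d‖² / 8)`. -/
lemma noiseLaw_closer_le {n : ℕ} (d : Fin n → ℝ) :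
    noiseLaw n {z | ∑ i, (z i + d i) ^ 2 ≤ ∑ i, z i ^ 2} ≤
      ENNReal.ofReal (Real.exp (-(∑ i, d i ^ 2) / 8)) := by
  -- A centred Gaussian of variance `S = ‖d‖²` must exceed `S / 2`; the Chernoff exponent `t² S / 2
  -- - t S / 2` is least at `t = 1 / 2`.
  have key := measure_ge_le_exp_mul_mgf (μ := noiseLaw n)
    (X := fun z : Fin n → ℝ => ∑ i, (-d i) * z i) ((∑ i, d i ^ 2) / 2) (t := 1 / 2) (by norm_num)
    (integrable_exp_sum_mul_noiseLaw _ _)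
  rw [mgf_sum_mul_noiseLaw, ← Real.exp_add] at key
  have hset : {z : Fin n → ℝ | ∑ i, (z i + d i) ^ 2 ≤ ∑ i, z i ^ 2} =
      {z | (∑ i, d i ^ 2) / 2 ≤ ∑ i, (-d i) * z i} := by
    ext z
    have : ∑ i, (z i + d i) ^ 2 = ∑ i, z i ^ 2 - 2 * (∑ i, (-d i) * z i) + ∑ i, d i ^ 2 := by
      rw [Finset.mul_sum, ← Finset.sum_sub_distrib, ← Finset.sum_add_distrib]
      exact Finset.sum_congr rfl fun i _ => by ring
    simp only [Set.mem_ofPred_eq, this]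
    constructor <;> intro h <;> linarith
  rw [hset, ← ofReal_measureReal]
  refine ENNReal.ofReal_le_ofReal (key.trans (Real.exp_le_exp.2 ?_))
  simp only [neg_sq]
  linarith

/-! ### Averaging over random signs -/

/-- Two points at distance `2a` cannot both lie within less than `a` of the origin. -/
lemma exp_add_exp_le {a x y : ℝ} (ha : 0 ≤ a) (h : |x - y| = 2 * a) :
    Real.exp (-x ^ 2 / 8) + Real.exp (-y ^ 2 / 8) ≤ 1 + Real.exp (-a ^ 2 / 8) := by
  have h1 : ∀ u : ℝ, Real.exp (-u ^ 2 / 8) ≤ 1 := fun u =>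
    Real.exp_le_one_iff.2 (by nlinarith [sq_nonneg u])
  have h2 : ∀ u : ℝ, a ≤ |u| → Real.exp (-u ^ 2 / 8) ≤ Real.exp (-a ^ 2 / 8) := by
    intro u hu
    refine Real.exp_le_exp.2 ?_
    have : a ^ 2 ≤ u ^ 2 := by rw [← sq_abs u]; gcongr
    linarith
  rcases le_or_gt a |x| with hx | hx
  · linarith [h1 y, h2 x hx]
  · have : |x - y| ≤ |x| + |y| := abs_sub x y
    linarith [h1 x, h2 y (by linarith)]

/-- One coordinate of the received signal for the messages `w`, with antipodal codeword symbols
of energy `P` and signs `b`. -/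
noncomputable def signedSum {ℓ M : ℕ} (P : ℝ) (b : Fin ℓ × Fin (M + 1) → Bool)
    (w : Fin ℓ → Fin (M + 1)) : ℝ :=
  ∑ k, if w k = 0 then 0 else if b (k, w k) then √P else -√P

/-- Reverses the sign at `x`. -/
def flipAt {X : Type*} [DecidableEq X] (x : X) (b : X → Bool) : X → Bool :=
  Function.update b x (!b x)

lemma flipAt_flipAt {X : Type*} [DecidableEq X] (x : X) (b : X → Bool) :
    flipAt x (flipAt x b) = b := by
  simp [flipAt]

lemma signedSum_flipAt_of_ne {ℓ M : ℕ} (P : ℝ) (b : Fin ℓ × Fin (M + 1) → Bool)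
    {w : Fin ℓ → Fin (M + 1)} {k : Fin ℓ} {m : Fin (M + 1)} (h : w k ≠ m) :
    signedSum P (flipAt (k, m) b) w = signedSum P b w := by
  refine Finset.sum_congr rfl fun j _ => ?_
  have : (j, w j) ≠ (k, m) := by
    rintro ⟨⟩
    exact h rfl
  simp [flipAt, Function.update_of_ne this]

lemma abs_signedSum_flipAt_sub {ℓ M : ℕ} (P : ℝ) (b : Fin ℓ × Fin (M + 1) → Bool)
    {w : Fin ℓ → Fin (M + 1)} {k : Fin ℓ} (h : w k ≠ 0) :
    |signedSum P (flipAt (k, w k) b) w - signedSum P b w| = 2 * √P := by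
  unfold signedSum
  rw [← Finset.sum_sub_distrib, Finset.sum_eq_single k]
  · have h2 : 0 ≤ √P := Real.sqrt_nonneg P
    cases hb : b (k, w k) <;> simp [h, flipAt, hb]
    · rw [← two_mul, abs_of_nonneg (by positivity)]
    · rw [show -√P - √P = -(2 * √P) by ring, abs_neg, abs_of_nonneg (by positivity)]
  · intro j _ hj
    have : (j, w j) ≠ (k, w k) := by
      intro e
      exact hj (congrArg Prod.fst e)
    simp [flipAt, Function.update_of_ne this]
  · simp

/-- The average over the signs of one coordinate's factor of the pairwise error bound. -/
lemma sum_exp_signedSum_sub_le {ℓ M : ℕ} {P : ℝ} (hP : 0 ≤ P) {w w' : Fin ℓ → Fin (M + 1)}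
    (hw : w ≠ w') :
    ∑ b : Fin ℓ × Fin (M + 1) → Bool, Real.exp (-(signedSum P b w - signedSum P b w') ^ 2 / 8) ≤
      Fintype.card (Fin ℓ × Fin (M + 1) → Bool) * ((1 + Real.exp (-P / 8)) / 2) := by
  -- Take a user `k` whose messages differ, and a nonzero one of the two: its sign enters exactly
  -- one of the two signals.
  obtain ⟨x, hx⟩ : ∃ x : Fin ℓ × Fin (M + 1), ∀ b,
      |(signedSum P (flipAt x b) w - signedSum P (flipAt x b) w') -
        (signedSum P b w - signedSum P b w')| = 2 * √P := by
    obtain ⟨k, hk⟩ := Function.ne_iff.1 hw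
    by_cases h0 : w k = 0
    · refine ⟨(k, w' k), fun b => ?_⟩
      have h1 : w' k ≠ 0 := fun h => hk (h0.trans h.symm)
      rw [signedSum_flipAt_of_ne P b hk, ← abs_signedSum_flipAt_sub P b h1, abs_sub_comm]
      congr 1
      ring
    · refine ⟨(k, w k), fun b => ?_⟩
      rw [signedSum_flipAt_of_ne P b hk.symm, ← abs_signedSum_flipAt_sub P b h0]
      congr 1
      ring
  set g : (Fin ℓ × Fin (M + 1) → Bool) → ℝ :=
    fun b => Real.exp (-(signedSum P b w - signedSum P b w') ^ 2 / 8) with hg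
  -- Flipping is an involution, so the average may be taken over pairs `b`, `flipAt x b`, whose
  -- differences are `2√P` apart.
  have hflip : ∑ b, g (flipAt x b) = ∑ b, g b :=
    Equiv.sum_comp (Function.Involutive.toPerm _ (flipAt_flipAt x)) g
  have hle : ∑ b, (g (flipAt x b) + g b) ≤
      ∑ _b : Fin ℓ × Fin (M + 1) → Bool, (1 + Real.exp (-P / 8)) := by
    refine Finset.sum_le_sum fun b _ => ?_
    have := exp_add_exp_le (Real.sqrt_nonneg P) (hx b)
    rwa [Real.sq_sqrt hP] at this
  rw [Finset.sum_add_distrib, hflip, Finset.sum_const, Finset.card_univ, nsmul_eq_mul] at hle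
  linarith

/-- The signs of different coordinates are independent, so the average factors into `n`
single-coordinate averages. -/
lemma sum_exp_sum_signedSum_sub_le {ℓ M : ℕ} (n : ℕ) {P : ℝ} (hP : 0 ≤ P)
    {w w' : Fin ℓ → Fin (M + 1)} (hw : w ≠ w') :
    ∑ b : Fin n → Fin ℓ × Fin (M + 1) → Bool,
      Real.exp (-(∑ i, (signedSum P (b i) w - signedSum P (b i) w') ^ 2) / 8) ≤
      Fintype.card (Fin n → Fin ℓ × Fin (M + 1) → Bool) * ((1 + Real.exp (-P / 8)) / 2) ^ n := by
  have h : ∀ b : Fin n → Fin ℓ × Fin (M + 1) → Bool,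
      Real.exp (-(∑ i, (signedSum P (b i) w - signedSum P (b i) w') ^ 2) / 8) =
      ∏ i, Real.exp (-(signedSum P (b i) w - signedSum P (b i) w') ^ 2 / 8) := by
    intro b
    rw [← Real.exp_sum, ← Finset.sum_neg_distrib, Finset.sum_div]
  simp_rw [h]
  rw [← Fintype.prod_sum fun (_ : Fin n) (c : Fin ℓ × Fin (M + 1) → Bool) =>
    Real.exp (-(signedSum P c w - signedSum P c w') ^ 2 / 8)]
  rw [Finset.prod_const, Finset.card_univ, Fintype.card_fin, Fintype.card_fun (α := Fin n),
    Fintype.card_fin]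
  push_cast
  rw [← mul_pow]
  gcongr
  · exact_mod_cast sum_exp_signedSum_sub_le hP hw

/-! ### Message law and number of active users -/

lemma messageLaw_apply {M : ℕ} (α : ℝ) (S : Set (Fin (M + 1))) [DecidablePred (· ∈ S)] :
    messageLaw M α S = ∑ w : Fin (M + 1),
      if w ∈ S then (if w = 0 then ENNReal.ofReal (1 - α) else ENNReal.ofReal (α / M)) else 0 := by
  simp only [messageLaw, Measure.coe_finsetSum, Finset.sum_apply, Measure.smul_apply, smul_eq_mul]
  refine Finset.sum_congr rfl fun w _ => ?_
  rw [Measure.dirac_apply' _ (Set.toFinite S).measurableSet]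
  by_cases h : w ∈ S <;> simp [h]

lemma natCast_mul_ofReal_div {M : ℕ} (hM : 0 < M) (α : ℝ) :
    (M : ENNReal) * ENNReal.ofReal (α / M) = ENNReal.ofReal α := by
  rw [← ENNReal.ofReal_natCast, ← ENNReal.ofReal_mul (by positivity)]
  congr 1
  field_simp

lemma isProbabilityMeasure_messageLaw {M : ℕ} (hM : 0 < M) {α : ℝ}
    (hα : α ∈ Set.Icc (0 : ℝ) 1) : IsProbabilityMeasure (messageLaw M α) := by
  constructor
  classical
  rw [messageLaw_apply, Fin.sum_univ_succ]
  simp [Fin.succ_ne_zero, natCast_mul_ofReal_div hM]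
  rw [← ENNReal.ofReal_add (by linarith [hα.2]) hα.1]
  simp

lemma messageLaw_ne_zero {M : ℕ} (hM : 0 < M) (α : ℝ) :
    messageLaw M α {w | w ≠ 0} = ENNReal.ofReal α := by
  classical
  rw [messageLaw_apply, Fin.sum_univ_succ]
  simp [Fin.succ_ne_zero, natCast_mul_ofReal_div hM]

/-- The number of active users. -/
def activeCount {ℓ M : ℕ} (w : Fin ℓ → Fin (M + 1)) : ℕ :=
  (Finset.univ.filter fun k => w k ≠ 0).card

/-- Markov's inequality for a count of mean `α ℓ`; being an integer, it exceeds `A` only if it is at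
least `A + 1`. -/
lemma measure_lt_activeCount_le {ℓ M : ℕ} (hM : 0 < M) {α : ℝ} (hα : α ∈ Set.Icc (0 : ℝ) 1)
    (A : ℕ) :
    (Measure.pi fun _ : Fin ℓ => messageLaw M α) {w | A < activeCount w} ≤
      ENNReal.ofReal (α * ℓ / (A + 1)) := by
  have := isProbabilityMeasure_messageLaw hM hα
  set μ := Measure.pi fun _ : Fin ℓ => messageLaw M α
  have hsing : ∀ k : Fin ℓ, ∫⁻ w : Fin ℓ → Fin (M + 1), (if w k ≠ 0 then 1 else 0) ∂μ =
      ENNReal.ofReal α := by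
    intro k
    have h1 : (fun w : Fin ℓ → Fin (M + 1) => if w k ≠ 0 then (1 : ENNReal) else 0) =
        Set.indicator ((fun w => w k) ⁻¹' {m : Fin (M + 1) | m ≠ 0}) 1 := by
      funext w
      simp [Set.indicator_apply]
    rw [h1, lintegral_indicator_one (Set.toFinite _).measurableSet,
      (measurePreserving_eval (fun _ : Fin ℓ => messageLaw M α) k).measure_preimage
        (Set.toFinite _).measurableSet.nullMeasurableSet]
    exact messageLaw_ne_zero hM α
  have hint : ∫⁻ w, (activeCount w : ENNReal) ∂μ = ENNReal.ofReal (α * ℓ) := by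
    have h2 : ∀ w : Fin ℓ → Fin (M + 1), (activeCount w : ENNReal) =
        ∑ k, if w k ≠ 0 then 1 else 0 := by
      intro w
      rw [activeCount, Finset.card_filter]
      push_cast
      rfl
    simp_rw [h2]
    rw [lintegral_finsetSum _ fun k _ => measurable_of_finite _]
    simp_rw [hsing]
    rw [Finset.sum_const, Finset.card_univ, Fintype.card_fin, nsmul_eq_mul, mul_comm,
      ENNReal.ofReal_mul hα.1, ENNReal.ofReal_natCast]
  have hset : {w : Fin ℓ → Fin (M + 1) | A < activeCount w} =
      {w | ((A + 1 : ℕ) : ENNReal) ≤ (activeCount w : ENNReal)} := by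
    ext w
    simp only [Set.mem_ofPred_eq, Nat.cast_le]
    rfl
  rw [hset]
  refine (meas_ge_le_lintegral_div (measurable_of_finite _).aemeasurable (by simp)
    (ENNReal.natCast_ne_top _)).trans ?_
  rw [hint, ENNReal.ofReal_div_of_pos (by positivity)]
  gcongr
  rw [← Nat.cast_succ, ENNReal.ofReal_natCast]

/-! ### Decoding, counting and random coding -/

/-- A measurable nearest-point decoder. -/
lemma exists_measurable_decoder {ι : Type*} [Finite ι] [Nonempty ι] [MeasurableSpace ι] {n : ℕ}
    (x : ι → Fin n → ℝ) (s : Set ι) :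
    ∃ D : (Fin n → ℝ) → ι, Measurable D ∧ ∀ w ∈ s, ∀ y,
      (∀ w' ∈ s, w' ≠ w → ∑ i, (y i - x w i) ^ 2 < ∑ i, (y i - x w' i) ^ 2) → D y = w := by
  let U : ι → Set (Fin n → ℝ) := fun w => {y | w ∈ s ∧
    ∀ w' ∈ s, w' ≠ w → ∑ i, (y i - x w i) ^ 2 < ∑ i, (y i - x w' i) ^ 2}
  have hU : ∀ w, MeasurableSet (U w) := by
    intro w
    have : U w = {_y | w ∈ s} ∩ ⋂ w' ∈ s, ⋂ (_ : w' ≠ w),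
        {y : Fin n → ℝ | ∑ i, (y i - x w i) ^ 2 < ∑ i, (y i - x w' i) ^ 2} := by
      ext y
      simp [U]
    rw [this]
    refine (MeasurableSet.const _).inter (MeasurableSet.iInter fun w' => MeasurableSet.iInter
      fun _ => MeasurableSet.iInter fun _ => measurableSet_lt ?_ ?_) <;> fun_prop
  -- Strict inequalities make the regions `U w` disjoint, so ties need no rule.
  obtain ⟨D, hD, h⟩ := exists_measurable_piecewise U hU (fun w _ => w)
    (fun w => measurable_const) (fun w w' hne y hy =>
      absurd (hy.1.2 w' hy.2.1 hne.symm) (hy.2.2 w hy.1.1 hne).not_gt)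
  exact ⟨D, hD, fun w hw y hy => h w ⟨hw, hy⟩⟩

/-- The message vectors with at most `A` active users. -/
def sparseMessages (ℓ M A : ℕ) : Finset (Fin ℓ → Fin (M + 1)) :=
  Finset.univ.filter fun w => activeCount w ≤ A

/-- The generating function of the active count is `(1 + M t)^ℓ`. At `t = 1 / (M ℓ)` it is at most
`e`, while each sparse vector contributes at least `t^A`. -/
lemma card_sparseMessages_le {ℓ M : ℕ} (A : ℕ) (hℓ : 0 < ℓ) (hM : 0 < M) :
    ((sparseMessages ℓ M A).card : ℝ) ≤ Real.exp 1 * ((M : ℝ) * ℓ) ^ A := by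
  set t : ℝ := 1 / (M * ℓ) with ht
  have hMℓ : (1 : ℝ) ≤ M * ℓ := by exact_mod_cast Nat.mul_pos hM hℓ
  have ht0 : 0 < t := by positivity
  have ht1 : t ≤ 1 := by rw [ht, div_le_one (by linarith)]; exact hMℓ
  have hprod : ∀ w : Fin ℓ → Fin (M + 1), ∏ k, (if w k ≠ 0 then t else 1) = t ^ activeCount w := by
    intro w
    rw [Finset.prod_ite]
    simp [activeCount]
  have hsum : ∑ w : Fin ℓ → Fin (M + 1), t ^ activeCount w = (1 + M * t) ^ ℓ := by
    simp_rw [← hprod]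
    rw [← Fintype.prod_sum fun (_ : Fin ℓ) (m : Fin (M + 1)) => if m ≠ 0 then t else 1]
    simp [Fin.sum_univ_succ, Fin.succ_ne_zero]
  have h1 : (sparseMessages ℓ M A).card * t ^ A ≤ (1 + M * t) ^ ℓ := by
    rw [← hsum, ← nsmul_eq_mul, ← Finset.sum_const]
    refine (Finset.sum_le_sum fun w hw => ?_).trans
      (Finset.sum_le_univ_sum_of_nonneg fun w => by positivity)
    exact pow_le_pow_of_le_one ht0.le ht1 (Finset.mem_filter.1 hw).2
  have h2 : (1 + M * t) ^ ℓ ≤ Real.exp 1 := by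
    have hMt : (M : ℝ) * t = 1 / ℓ := by rw [ht]; field_simp
    calc (1 + M * t) ^ ℓ ≤ (Real.exp (1 / ℓ)) ^ ℓ := by
          rw [hMt, add_comm]
          gcongr
          exact Real.add_one_le_exp _
      _ = Real.exp 1 := by
          rw [← Real.exp_nat_mul]
          congr 1
          field_simp
  have h3 : t ^ A * ((M : ℝ) * ℓ) ^ A = 1 := by
    rw [← mul_pow, ht, one_div_mul_cancel (by positivity), one_pow]
  calc ((sparseMessages ℓ M A).card : ℝ)
      = (sparseMessages ℓ M A).card * t ^ A * ((M : ℝ) * ℓ) ^ A := by rw [mul_assoc, h3, mul_one]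
    _ ≤ _ := by gcongr; exact h1.trans h2

/-- The antipodal code with signs `b` and a nearest-point decoder for at most `A` active users. -/
lemma exists_symmetricCode_of_signs {P : ℝ} (hP : 0 ≤ P) {ℓ M n : ℕ} (hM : 0 < M) (A : ℕ)
    {α : ℝ} (hα : α ∈ Set.Icc (0 : ℝ) 1) (b : Fin n → Fin ℓ × Fin (M + 1) → Bool) :
    ∃ C : SymmetricCode ℓ M n P, C.errorProb α ≤ ENNReal.ofReal (α * ℓ / (A + 1)) +
      ENNReal.ofReal (∑ p ∈ (sparseMessages ℓ M A).offDiag,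
        Real.exp (-(∑ i, (signedSum P (b i) p.1 - signedSum P (b i) p.2) ^ 2) / 8)) := by
  obtain ⟨D, hD, hDspec⟩ := exists_measurable_decoder
    (fun (w : Fin ℓ → Fin (M + 1)) i => signedSum P (b i) w) (sparseMessages ℓ M A : Set _)
  let C : SymmetricCode ℓ M n P :=
    { encode := fun k m i => if m = 0 then 0 else if b i (k, m) then √P else -√P
      encode_zero := fun k => by funext i; simp
      power_le := fun k m => by
        have h : ∀ i, (if m = 0 then 0 else if b i (k, m) then √P else -√P) ^ 2 ≤ P := by
          intro i
          split_ifs <;> simp [Real.sq_sqrt hP, hP]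
        rcases Nat.eq_zero_or_pos n with rfl | hn
        · simpa using hP
        · calc 1 / (n : ℝ) * ∑ i, (if m = 0 then 0 else if b i (k, m) then √P else -√P) ^ 2
              ≤ 1 / (n : ℝ) * ∑ _i : Fin n, P := by gcongr with i; exact h i
            _ = P := by
              rw [Finset.sum_const, Finset.card_univ, Fintype.card_fin, nsmul_eq_mul]
              field_simp
      decode := D
      measurable_decode := hD }
  refine ⟨C, ?_⟩
  have hrec : ∀ w z i, C.received w z i = z i + signedSum P (b i) w := by
    intro w z i
    simp [SymmetricCode.received, C, signedSum, Finset.sum_apply, add_comm]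
  have := isProbabilityMeasure_messageLaw hM hα
  unfold SymmetricCode.errorProb
  set μ := Measure.pi fun _ : Fin ℓ => messageLaw M α
  -- An error needs too many active users, or a sparse competitor at least as close as the truth.
  have hsub : {p : (Fin ℓ → Fin (M + 1)) × (Fin n → ℝ) | C.decode (C.received p.1 p.2) ≠ p.1} ⊆
      ({w | A < activeCount w} ×ˢ Set.univ) ∪ ⋃ p ∈ (sparseMessages ℓ M A).offDiag,
        ({p.1} : Set (Fin ℓ → Fin (M + 1))) ×ˢ {z : Fin n → ℝ |
          ∑ i, (z i + (signedSum P (b i) p.1 - signedSum P (b i) p.2)) ^ 2 ≤ ∑ i, z i ^ 2} := by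
    rintro ⟨w, z⟩ hwz
    by_contra hnot
    simp only [Set.mem_union, Set.mem_prod, Set.mem_ofPred_eq, Set.mem_univ, and_true, not_or,
      not_lt, Set.mem_iUnion, Set.mem_singleton_iff, not_exists, not_and, not_le] at hnot
    have hw : w ∈ sparseMessages ℓ M A := Finset.mem_filter.2 ⟨Finset.mem_univ _, hnot.1⟩
    refine hwz (hDspec w hw _ fun w' hw' hne => ?_)
    have := hnot.2 (w, w') (Finset.mem_offDiag.2 ⟨hw, hw', hne.symm⟩) rfl
    simpa only [hrec, add_sub_cancel_right, add_sub_assoc] using this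
  refine (measure_mono hsub).trans ((measure_union_le _ _).trans (add_le_add ?_ ?_))
  · rw [Measure.prod_prod, measure_univ, mul_one]
    exact measure_lt_activeCount_le hM hα A
  · refine (measure_biUnion_finset_le _ _).trans ?_
    rw [ENNReal.ofReal_sum_of_nonneg fun _ _ => by positivity]
    refine Finset.sum_le_sum fun p _ => ?_
    rw [Measure.prod_prod]
    exact (mul_le_of_le_one_left' prob_le_one).trans (noiseLaw_closer_le _)

/-- Random coding bound. -/
lemma exists_symmetricCode {P : ℝ} (hP : 0 ≤ P) {ℓ M : ℕ} (n : ℕ) (hℓ : 0 < ℓ) (hM : 0 < M)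
    (A : ℕ) {α : ℝ} (hα : α ∈ Set.Icc (0 : ℝ) 1) :
    ∃ C : SymmetricCode ℓ M n P, C.errorProb α ≤ ENNReal.ofReal (α * ℓ / (A + 1)) +
      ENNReal.ofReal ((Real.exp 1 * ((M : ℝ) * ℓ) ^ A) ^ 2 *
        ((1 + Real.exp (-P / 8)) / 2) ^ n) := by
  set T := (sparseMessages ℓ M A).offDiag
  set ρ : ℝ := (1 + Real.exp (-P / 8)) / 2
  have hρ : 0 ≤ ρ := by positivity
  have hsum : ∑ b : Fin n → Fin ℓ × Fin (M + 1) → Bool, ∑ p ∈ T,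
      Real.exp (-(∑ i, (signedSum P (b i) p.1 - signedSum P (b i) p.2) ^ 2) / 8) ≤
      ∑ _b : Fin n → Fin ℓ × Fin (M + 1) → Bool, T.card * ρ ^ n := by
    rw [Finset.sum_comm, Finset.sum_const, Finset.card_univ, nsmul_eq_mul]
    refine (Finset.sum_le_sum fun p hp =>
      sum_exp_sum_signedSum_sub_le n hP (Finset.mem_offDiag.1 hp).2.2).trans ?_
    rw [Finset.sum_const, nsmul_eq_mul]
    exact le_of_eq (by ring)
  -- Some choice of signs does no worse than the average.
  obtain ⟨b, -, hb⟩ := Finset.exists_le_of_sum_le Finset.univ_nonempty hsum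
  obtain ⟨C, hC⟩ := exists_symmetricCode_of_signs hP hM A hα b
  refine ⟨C, hC.trans (add_le_add le_rfl (ENNReal.ofReal_le_ofReal (hb.trans ?_)))⟩
  have hT : (T.card : ℝ) ≤ ((sparseMessages ℓ M A).card : ℝ) ^ 2 := by
    rw [sq]
    exact_mod_cast (Finset.offDiag_card _).trans_le (Nat.sub_le _ _)
  gcongr
  exact hT.trans (by gcongr; exact card_sparseMessages_le A hℓ hM)

/-! ### Asymptotics -/

/-- Nearly optimal choices tend to zero when the optimal values do. -/
lemma exists_tendsto_zero_of_eventually_exists_le {X : ℕ → Type*} [∀ n, Nonempty (X n)]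
    (f : ∀ n, X n → ENNReal) (h : ∀ η : ENNReal, 0 < η → ∀ᶠ n in atTop, ∃ x, f n x ≤ η) :
    ∃ x : ∀ n, X n, Tendsto (fun n => f n (x n)) atTop (𝓝 0) := by
  have hx : ∀ n, ∃ x, f n x ≤ (⨅ y, f n y) + ((n : ENNReal) + 1)⁻¹ := by
    intro n
    by_cases ht : (⨅ y, f n y) = ⊤
    · exact ⟨Classical.arbitrary _, by simp [ht]⟩
    · obtain ⟨x, hx⟩ := iInf_lt_iff.1 (ENNReal.lt_add_right ht
        (b := ((n : ENNReal) + 1)⁻¹) (by simp))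
      exact ⟨x, hx.le⟩
  choose x hx using hx
  refine ⟨x, ?_⟩
  have h1 : Tendsto (fun n => ⨅ y, f n y) atTop (𝓝 0) := by
    rw [ENNReal.tendsto_nhds_zero]
    intro η hη
    filter_upwards [h η hη] with n ⟨y, hy⟩ using (iInf_le _ y).trans hy
  have h2 : Tendsto (fun n : ℕ => ((n : ENNReal) + 1)⁻¹) atTop (𝓝 0) := by
    have := (tendsto_add_atTop_iff_nat 1).2 ENNReal.tendsto_inv_nat_nhds_zero
    simpa using this
  exact tendsto_of_tendsto_of_tendsto_of_le_of_le tendsto_const_nhds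
    (by simpa using h1.add h2) (fun _ => zero_le) hx

/-- Eventually `ℓ n ≤ exp (s n)`, so a bound on `s` would bound `ℓ`; by monotonicity, unboundedness
of `s` is enough. -/
lemma tendsto_atTop_of_mul_exp_tendsto_zero {ℓ : ℕ → ℕ} (hℓ : ¬ BddAbove (Set.range ℓ))
    {s : ℕ → ℝ} (hs_mono : Monotone s)
    (hs_exp : Tendsto (fun n => (ℓ n : ℝ) * Real.exp (-1 * s n)) atTop (𝓝 0)) :
    Tendsto s atTop atTop := by
  refine tendsto_atTop_atTop_of_monotone hs_mono fun b => ?_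
  by_contra! hb
  refine hℓ (Filter.IsBoundedUnder.bddAbove_range ⟨⌈Real.exp b⌉₊, ?_⟩)
  rw [eventually_map]
  filter_upwards [hs_exp.eventually_lt_const one_pos] with n hn
  have h1 : (ℓ n : ℝ) ≤ Real.exp (s n) := by
    have h2 := mul_le_mul_of_nonneg_right hn.le (Real.exp_pos (s n)).le
    rwa [mul_assoc, ← Real.exp_add, neg_one_mul, neg_add_cancel, Real.exp_zero, mul_one,
      one_mul] at h2
  exact_mod_cast h1.trans ((Real.exp_le_exp.2 (hb n).le).trans (Nat.le_ceil _))

/-- With `s n ≤ c n`, the decay hypothesis at rate `δ / c` gives the bound. -/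
lemma eventually_le_exp_mul {ℓ : ℕ → ℕ} {s : ℕ → ℝ} (hs_O : s =O[atTop] fun n => (n : ℝ))
    (hs_exp : ∀ δ : ℝ, 0 < δ →
      Tendsto (fun n => (ℓ n : ℝ) * Real.exp (-δ * s n)) atTop (𝓝 0)) {δ : ℝ} (hδ : 0 < δ) :
    ∀ᶠ n : ℕ in atTop, (ℓ n : ℝ) ≤ Real.exp (δ * n) := by
  obtain ⟨c, hc, hsc⟩ := hs_O.exists_pos
  filter_upwards [hsc.bound, (hs_exp (δ / c) (by positivity)).eventually_lt_const one_pos]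
    with n h1 h2
  have h3 := mul_le_mul_of_nonneg_right h2.le (Real.exp_pos (δ / c * s n)).le
  rw [mul_assoc, ← Real.exp_add, neg_mul, neg_add_cancel, Real.exp_zero, mul_one, one_mul] at h3
  refine h3.trans (Real.exp_le_exp.2 ?_)
  rw [Real.norm_eq_abs, Real.norm_eq_abs, Nat.abs_cast] at h1
  calc δ / c * s n ≤ δ / c * (c * n) := by gcongr; exact (le_abs_self _).trans h1
    _ = δ * n := by field_simp

lemma tendsto_log_one_add_mul_div {P : ℝ} (hP : 0 < P) :
    Tendsto (fun x : ℝ => Real.log (1 + x * P) / (2 * x)) atTop (𝓝 0) := by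
  have h1 : Tendsto (fun x : ℝ => 1 + x * P) atTop atTop :=
    tendsto_atTop_add_const_left _ _ (tendsto_id.atTop_mul_const hP)
  have h2 : (fun x : ℝ => 1 + x * P) =O[atTop] fun x => 2 * x := by
    refine IsBigO.of_bound (1 + P) ?_
    filter_upwards [eventually_ge_atTop 1] with x hx
    rw [Real.norm_of_nonneg (by positivity), Real.norm_of_nonneg (by positivity)]
    nlinarith [mul_pos (zero_lt_one.trans_le hx) hP]
  exact ((Real.isLittleO_log_id_atTop.comp_tendsto h1).trans_isBigO h2).tendsto_div_nhds_zero

/-- If the message lengths and the logarithms of the numbers of users are `o(n)`, and the average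
numbers of active users are bounded, then the message lengths are achievable. -/
theorem asymptoticallyAchievable_of_sublinear {P : ℝ} (hP : 0 < P) {ℓ : ℕ → ℕ} {α : ℕ → ℝ}
    (hα : ∀ n, α n ∈ Set.Icc (0 : ℝ) 1) (hℓ : ∀ᶠ n in atTop, 0 < ℓ n)
    (hk : BddAbove (Set.range fun n => α n * (ℓ n : ℝ))) {v : ℕ → ℝ}
    (hℓ_exp : ∀ δ : ℝ, 0 < δ → ∀ᶠ n : ℕ in atTop, (ℓ n : ℝ) ≤ Real.exp (δ * n))
    (hv : ∀ δ : ℝ, 0 < δ → ∀ᶠ n : ℕ in atTop, v n ≤ δ * n) :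
    AsymptoticallyAchievable ℓ α P v := by
  have hM : ∀ n, 0 < ⌈Real.exp (v n)⌉₊ := fun n => Nat.ceil_pos.2 (Real.exp_pos _)
  have : ∀ n, Nonempty (SymmetricCode (ℓ n) ⌈Real.exp (v n)⌉₊ n P) := fun n =>
    ⟨(exists_symmetricCode_of_signs hP.le (hM n) 0 (hα n) fun _ _ => true).choose⟩
  refine exists_tendsto_zero_of_eventually_exists_le
    (fun n (C : SymmetricCode (ℓ n) ⌈Real.exp (v n)⌉₊ n P) => C.errorProb (α n)) fun η hη => ?_
  obtain ⟨K, hK⟩ := hk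
  have hA : Tendsto (fun A : ℕ => ENNReal.ofReal (K / (A + 1))) atTop (𝓝 0) := by
    have : Tendsto (fun A : ℕ => K / ((A : ℝ) + 1)) atTop (𝓝 0) :=
      tendsto_const_nhds.div_atTop (tendsto_atTop_add_const_right _ _ tendsto_natCast_atTop_atTop)
    simpa using ENNReal.tendsto_ofReal this
  obtain ⟨A, hA⟩ := (hA.eventually_lt_const (ENNReal.half_pos hη.ne')).exists
  set ρ : ℝ := (1 + Real.exp (-P / 8)) / 2 with hρ
  have hρ0 : 0 < ρ := by positivity
  have hρ1 : ρ < 1 := by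
    have : Real.exp (-P / 8) < 1 := Real.exp_lt_one_iff.2 (by linarith)
    rw [hρ]
    linarith
  -- The squared count of sparse vectors grows like `exp (4 A δ n)`, as `M` and `ℓ` are each of
  -- order at most `exp (δ n)`. This `δ` makes `exp (4 A δ) ρ = exp (-4 δ) < 1`.
  set δ : ℝ := -Real.log ρ / (4 * (A + 1)) with hδ_def
  have hlog : Real.log ρ < 0 := Real.log_neg hρ0 hρ1
  have hδ : 0 < δ := div_pos (by linarith) (by positivity)
  have hdecay : Real.exp (4 * A * δ) * ρ < 1 := by
    have h1 : Real.log ρ = -(4 * (A + 1)) * δ := by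
      rw [hδ_def]
      field_simp
    rw [← Real.exp_log hρ0, ← Real.exp_add, h1, Real.exp_lt_one_iff]
    linarith
  have hlim : Tendsto (fun n : ℕ => ENNReal.ofReal
      ((Real.exp 1 * 2 ^ A) ^ 2 * (Real.exp (4 * A * δ) * ρ) ^ n)) atTop (𝓝 0) := by
    have h1 := (tendsto_pow_atTop_nhds_zero_of_lt_one (by positivity) hdecay).const_mul
      ((Real.exp 1 * 2 ^ A) ^ 2)
    simpa using ENNReal.tendsto_ofReal h1
  filter_upwards [hlim.eventually_lt_const (ENNReal.half_pos hη.ne'), hℓ, hℓ_exp δ hδ, hv δ hδ]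
    with n h1 h2 h3 h4
  obtain ⟨C, hC⟩ := exists_symmetricCode hP.le n h2 (hM n) A (hα n)
  refine ⟨C, hC.trans ((add_le_add ?_ ?_).trans (ENNReal.add_halves η).le)⟩
  · refine (ENNReal.ofReal_le_ofReal ?_).trans hA.le
    gcongr
    exact hK ⟨n, rfl⟩
  · refine (ENNReal.ofReal_le_ofReal ?_).trans h1.le
    have hceil : (⌈Real.exp (v n)⌉₊ : ℝ) ≤ 2 * Real.exp (δ * n) := by
      have h5 : Real.exp (v n) ≤ Real.exp (δ * n) := Real.exp_le_exp.2 h4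
      have h6 : 1 ≤ Real.exp (δ * n) := Real.one_le_exp (by positivity)
      linarith [Nat.ceil_lt_add_one (Real.exp_pos (v n)).le]
    calc (Real.exp 1 * ((⌈Real.exp (v n)⌉₊ : ℝ) * ℓ n) ^ A) ^ 2 * ρ ^ n
        ≤ (Real.exp 1 * (2 * Real.exp (δ * n) * Real.exp (δ * n)) ^ A) ^ 2 * ρ ^ n := by gcongr
      _ = (Real.exp 1 * 2 ^ A) ^ 2 * (Real.exp (4 * A * δ) * ρ) ^ n := by
        have h7 : Real.exp (4 * A * δ) ^ n = ((Real.exp (δ * n)) ^ A) ^ 4 := by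
          rw [← Real.exp_nat_mul, ← Real.exp_nat_mul, ← Real.exp_nat_mul]
          congr 1
          push_cast
          ring
        rw [mul_pow (Real.exp (4 * A * δ)), h7, mul_pow, mul_pow]
        ring

theorem theorem5
    (P : ℝ) (hP : 0 < P)
    (ℓ : ℕ → ℕ) (α : ℕ → ℝ) (hα : ∀ n, α n ∈ Set.Icc (0 : ℝ) 1)
    (hℓ : ¬ BddAbove (Set.range ℓ))
    (hk : BddAbove (Set.range fun n => α n * (ℓ n : ℝ)))
    (s : ℕ → ℝ) (hs_mono : Monotone s)
    (hs_le : ∀ᶠ n in atTop, s n ≤ (ℓ n : ℝ))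
    (hs_O : s =O[atTop] fun n => (n : ℝ))
    (hs_exp : ∀ δ : ℝ, 0 < δ →
      Tendsto (fun n => (ℓ n : ℝ) * Real.exp (-δ * s n)) atTop (𝓝 0))
    (hs_lim : ∃ θ : ℝ, θ < 1 ∧
      Tendsto (fun n : ℕ => 2 * (ℓ n : ℝ) * Real.binEntropy (s n / (ℓ n : ℝ)) /
        ((n : ℝ) * Real.log (1 + s n * P))) atTop (𝓝 θ))
    (ε : ℝ) (hε : ε ∈ Set.Ioo (0 : ℝ) 1) :
    AsymptoticallyAchievable ℓ α P (fun n =>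
      (1 - ε) * ((n : ℝ) / (2 * s n) * Real.log (1 + s n * P) -
        Real.binEntropy (s n / (ℓ n : ℝ)))) := by
  have hs := tendsto_atTop_of_mul_exp_tendsto_zero hℓ hs_mono (hs_exp 1 one_pos)
  have hs_pos : ∀ᶠ n in atTop, 0 < s n := hs.eventually_gt_atTop 0
  refine asymptoticallyAchievable_of_sublinear hP hα ?_ hk
    (fun δ hδ => eventually_le_exp_mul hs_O hs_exp hδ) fun δ hδ => ?_
  · filter_upwards [hs_pos, hs_le] with n h1 h2
    exact_mod_cast h1.trans_le h2
  · filter_upwards [hs_pos, hs_le,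
      ((tendsto_log_one_add_mul_div hP).comp hs).eventually_lt_const hδ] with n h1 h2 h3
    have hH : 0 ≤ Real.binEntropy (s n / ℓ n) :=
      Real.binEntropy_nonneg (by positivity) (div_le_one_of_le₀ h2 (Nat.cast_nonneg _))
    have hL : 0 ≤ Real.log (1 + s n * P) :=
      Real.log_nonneg (by linarith [mul_pos h1 hP])
    have ha : 0 ≤ (n : ℝ) / (2 * s n) * Real.log (1 + s n * P) := by positivity
    -- The entropy term and the factor `1 - ε` only shorten the message; the leading term is already
    -- `o(n)`.
    calc (1 - ε) * ((n : ℝ) / (2 * s n) * Real.log (1 + s n * P) - Real.binEntropy (s n / ℓ n))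
        ≤ (1 - ε) * ((n : ℝ) / (2 * s n) * Real.log (1 + s n * P)) := by
          have := hε.2
          gcongr
          linarith
      _ ≤ (n : ℝ) / (2 * s n) * Real.log (1 + s n * P) :=
          mul_le_of_le_one_left ha (by linarith [hε.1])
      _ = Real.log (1 + s n * P) / (2 * s n) * n := by ring
      _ ≤ δ * n := mul_le_mul_of_nonneg_right h3.le (Nat.cast_nonneg n)
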